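/- Fix $\epsilon\in(0,1)$. A \emph{2SUIG representation} of a finite graph $G$ assigns to every vertex a closed axis-parallel unit square in the plane that meets one of the two stab lines $y=1$ (lower) and $y=2+\epsilon$ (upper), such that two distinct vertices are adjacent if and only if their squares intersect. A graph with such a representation is a \emph{2-stab unit interval graph (2SUIG)}. Every square meets exactly one stab line, so a representation gives a \emph{vertex partition} $V(G)=V_1\sqcup V_2$, where $V_1$ (resp. $V_2$) consists of the vertices whose squares meet the lower (resp. upper) stab line. Theorem. All maximal cliques of a 2SUIG $G$ can be enumerated, and its clique number $\omega(G)$ can be computed, in polynomial time, if $G$ is given together with a vertex partition $V(G)=V_1\sqcup V_2$ that arises from some 2SUIG representation (the representation itself is not given). That is, there are a single program for a unit-cost random access machine (with addition, subtraction and comparison of natural numbers) and a polynomial $p$ such that, for every $\epsilon\in(0,1)$, every $n\ge 0$, every 2SUIG $G$ with vertex set $\{0,\dots,n-1\}$ and every such partition $V_1\sqcup V_2$ of it, the program, started on the adjacency matrix of $G$ and the characteristic vector of $V_1$, halts after at most $p(n)$ steps and outputs a list of vertex sets in which every maximal clique of $G$ occurs exactly once and nothing else occurs, and the number $\omega(G)$.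 -/

import Mathlib

/-! ### 2-stab interval graphs -/

/-- The closed axis-parallel rectangle `[l, r] × [b, b + 1]` of unit height. -/
def stabRect (l r b : ℝ) : Set (ℝ × ℝ) := Set.Icc l r ×ˢ Set.Icc b (b + 1)

/-- A 2-stab representation of a graph `G`, with lower stab line `y = 1` and upper stab line
`y = 2 + ε`: every vertex `v` gets the closed axis-parallel rectangle
`[left v, right v] × [bottom v, bottom v + 1]` of unit height, every rectangle meets one of the two
stab lines, and two distinct vertices are adjacent iff their rectangles meet. -/
structure TwoStabRep (ε : ℝ) {V : Type*} (G : SimpleGraph V) where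
  left : V → ℝ
  right : V → ℝ
  bottom : V → ℝ
  left_lt_right : ∀ v, left v < right v
  stab : ∀ v, ∃ q ∈ stabRect (left v) (right v) (bottom v), q.2 = 1 ∨ q.2 = 2 + ε
  adj_iff : ∀ u v, G.Adj u v ↔ u ≠ v ∧
    (stabRect (left u) (right u) (bottom u) ∩ stabRect (left v) (right v) (bottom v)).Nonempty

namespace TwoStabRep

variable {ε : ℝ} {V : Type*} {G : SimpleGraph V}

/-- The closed rectangle that represents the vertex `v`. -/
def rect (R : TwoStabRep ε G) (v : V) : Set (ℝ × ℝ) :=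
  stabRect (R.left v) (R.right v) (R.bottom v)

/-- The lower partition: the vertices whose rectangles meet the lower stab line. -/
def lower (R : TwoStabRep ε G) : Set V := {v | ∃ q ∈ R.rect v, q.2 = 1}

/-- The upper partition: the vertices whose rectangles meet the upper stab line. -/
def upper (R : TwoStabRep ε G) : Set V := {v | ∃ q ∈ R.rect v, q.2 = 2 + ε}

/-- All rectangles of the representation are unit squares: a 2SUIG representation. -/
def IsUnit (R : TwoStabRep ε G) : Prop := ∀ v, R.right v = R.left v + 1

end TwoStabRep

/-- `G` is a 2SUIG, and `V₁`, `V₂` are the lower and the upper partition of some 2SUIG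
representation of `G` (with stab lines `y = 1` and `y = 2 + ε`). -/
def IsTwoSUIGPartition (ε : ℝ) {V : Type*} (G : SimpleGraph V) (V₁ V₂ : Set V) : Prop :=
  ∃ R : TwoStabRep ε G, R.IsUnit ∧ R.lower = V₁ ∧ R.upper = V₂

/-! ### A random access machine with a step count

Programs are built from assignments, sequencing, branching and loops. They act on natural-number
variables and on one-dimensional arrays of natural numbers; a program is a finite object and names
finitely many variables and arrays. The only arithmetic is addition, truncated subtraction and
comparison, so that under the unit-cost measure below, polynomial time on this machine is polynomial
time on Turing machines. -/

namespace RAM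

/-- The memory: the variable `x` holds `var x`, the cell `i` of the array `a` holds `arr a i`. -/
@[ext]
structure State where
  var : ℕ → ℕ
  arr : ℕ → ℕ → ℕ

/-- Expressions. `lt` and `eq` are tests with value `1` (true) or `0` (false). -/
inductive Term where
  | const (c : ℕ)
  | var (x : ℕ)
  | read (a : ℕ) (i : Term)
  | add (e f : Term)
  | sub (e f : Term)
  | lt (e f : Term)
  | eq (e f : Term)

namespace Term

/-- The value of an expression. -/
def eval (s : State) : Term → ℕ
  | const c => c
  | var x => s.var x
  | read a i => s.arr a (i.eval s)
  | add e f => e.eval s + f.eval s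
  | sub e f => e.eval s - f.eval s
  | lt e f => if e.eval s < f.eval s then 1 else 0
  | eq e f => if e.eval s = f.eval s then 1 else 0

/-- The time to evaluate an expression: one step for every operation, constant and variable. -/
def cost : Term → ℕ
  | const _ => 1
  | var _ => 1
  | read _ i => i.cost + 1
  | add e f => e.cost + f.cost + 1
  | sub e f => e.cost + f.cost + 1
  | lt e f => e.cost + f.cost + 1
  | eq e f => e.cost + f.cost + 1

end Term

/-- Programs. -/
inductive Prog where
  | skip
  | assign (x : ℕ) (e : Term)
  | write (a : ℕ) (i e : Term)
  | seq (P Q : Prog)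
  | ite (c : Term) (P Q : Prog)
  | loop (c : Term) (P : Prog)

/-- `x := k`. -/
def State.setVar (s : State) (x k : ℕ) : State :=
  { s with var := Function.update s.var x k }

/-- `a[i] := k`. -/
def State.setArr (s : State) (a i k : ℕ) : State :=
  { s with arr := Function.update s.arr a (Function.update (s.arr a) i k) }

/-- `P.Runs s s' t`: started in the state `s`, the program `P` halts in the state `s'` after exactly
`t` steps. In `ite c P Q` and `loop c P` the test `c` counts as true iff its value is not `0`. -/
inductive Prog.Runs : Prog → State → State → ℕ → Prop where
  | skip (s : State) : Runs Prog.skip s s 1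
  | assign (x : ℕ) (e : Term) (s : State) :
      Runs (Prog.assign x e) s (s.setVar x (e.eval s)) (e.cost + 1)
  | write (a : ℕ) (i e : Term) (s : State) :
      Runs (Prog.write a i e) s (s.setArr a (i.eval s) (e.eval s)) (i.cost + e.cost + 1)
  | seq {P Q : Prog} {s s' s'' : State} {t t' : ℕ} :
      Runs P s s' t → Runs Q s' s'' t' → Runs (Prog.seq P Q) s s'' (t + t')
  | ite_true {c : Term} {P Q : Prog} {s s' : State} {t : ℕ} :
      c.eval s ≠ 0 → Runs P s s' t → Runs (Prog.ite c P Q) s s' (c.cost + 1 + t)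
  | ite_false {c : Term} {P Q : Prog} {s s' : State} {t : ℕ} :
      c.eval s = 0 → Runs Q s s' t → Runs (Prog.ite c P Q) s s' (c.cost + 1 + t)
  | loop_true {c : Term} {P : Prog} {s s' s'' : State} {t t' : ℕ} :
      c.eval s ≠ 0 → Runs P s s' t → Runs (Prog.loop c P) s' s'' t' →
        Runs (Prog.loop c P) s s'' (c.cost + 1 + t + t')
  | loop_false {c : Term} {P : Prog} {s : State} :
      c.eval s = 0 → Runs (Prog.loop c P) s s (c.cost + 1)

open Classical in
/-- The input: a graph on `n` vertices with its vertex partition `(V₁, V₁ᶜ)`. Variable `0` holds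
`n`, array `0` holds the adjacency matrix row by row, array `1` the characteristic vector of `V₁`;
everything else is `0`. -/
noncomputable def input {n : ℕ} (G : SimpleGraph (Fin n)) (V₁ : Set (Fin n)) : State where
  var x := if x = 0 then n else 0
  arr a k :=
    if a = 0 then (if ∃ u v : Fin n, G.Adj u v ∧ k = u.val * n + v.val then 1 else 0)
    else if a = 1 then (if ∃ v ∈ V₁, k = v.val then 1 else 0)
    else 0

/-- The vertex set number `i` of an output: row `i` (of length `n`) of the array `2`, read as a
characteristic vector. -/
def outputSet (n : ℕ) (s : State) (i : ℕ) : Finset (Fin n) :=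
  Finset.univ.filter fun v => s.arr 2 (i * n + v.val) = 1

/-- The list of vertex sets in an output: the rows `0, …, m - 1` of the array `2`, where the number
`m` is held by the variable `1`. -/
def outputList (n : ℕ) (s : State) : List (Finset (Fin n)) :=
  (List.range (s.var 1)).map (outputSet n s)

/-- The number in an output, held by the variable `2`. -/
def outputNumber (s : State) : ℕ := s.var 2

end RAM

/-!
Rectangles with sides parallel to the axes have the Helly property: finitely many of them that meet
pairwise have a common point. In a graph of such rectangles, let `K` be a nonempty maximal clique,
and choose in `K` the rectangles with the rightmost left side, the leftmost right side, the highest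
bottom and the lowest bottom. A rectangle that meets these four meets every rectangle of `K`, so
that `K` is exactly the common closed neighbourhood of four of its members
(`TwoStabRep.exists_isCliqueFrame`). Conversely, in every graph, the common closed neighbourhood of
four vertices is a maximal clique as soon as it is a clique that contains the four
(`SimpleGraph.IsCliqueFrame.maximal`).

Hence the maximal cliques of a graph with `n` vertices are found by running through the `n ^ 4`
quadruples of vertices, keeping the common closed neighbourhoods that pass this test and have not
been listed before. The largest of them has the size of a largest clique. The program
`RAM.listCliques` does this, without use of the vertex partition. Its analysis rests on triples
`RAM.Prog.Ensures` that combine a time bound with a postcondition, the invariant rule for counting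
loops (`RAM.Prog.ensures_forRange`), and the fact that a program changes only those variables and
arrays to which it assigns (`RAM.Prog.Runs.frame`).
-/

/-! ### Maximal cliques of graphs of rectangles -/

namespace SimpleGraph

variable {V : Type*} [Fintype V] (G : SimpleGraph V)

open Classical in
/-- The common closed neighbourhood of four vertices. -/
noncomputable def commonNbhd (q : V × V × V × V) : Finset V :=
  Finset.univ.filter fun w =>
    (q.1 = w ∨ G.Adj q.1 w) ∧ (q.2.1 = w ∨ G.Adj q.2.1 w) ∧
      (q.2.2.1 = w ∨ G.Adj q.2.2.1 w) ∧ (q.2.2.2 = w ∨ G.Adj q.2.2.2 w)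

/-- The four vertices lie in their common closed neighbourhood, and it is a clique. -/
def IsCliqueFrame (q : V × V × V × V) : Prop :=
  (q.1 ∈ G.commonNbhd q ∧ q.2.1 ∈ G.commonNbhd q ∧ q.2.2.1 ∈ G.commonNbhd q ∧
    q.2.2.2 ∈ G.commonNbhd q) ∧
  ∀ u v, u ∈ G.commonNbhd q → v ∈ G.commonNbhd q → u = v ∨ G.Adj u v

variable {G}

theorem IsCliqueFrame.isClique {q : V × V × V × V} (h : G.IsCliqueFrame q) :
    G.IsClique (G.commonNbhd q : Set V) := fun u hu v hv huv =>
  (h.2 u v (by simpa using hu) (by simpa using hv)).resolve_left huv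

theorem IsCliqueFrame.maximal {q : V × V × V × V} (h : G.IsCliqueFrame q) :
    Maximal G.IsClique (G.commonNbhd q : Set V) := by
  refine ⟨h.isClique, fun K hK hle w hw => ?_⟩
  have key : ∀ x ∈ G.commonNbhd q, x = w ∨ G.Adj x w := fun x hx =>
    or_iff_not_imp_left.2 fun hne => hK (hle (by simpa using hx)) hw hne
  simp only [commonNbhd, Finset.coe_filter, Finset.mem_univ, true_and, Set.mem_ofPred_eq]
  exact ⟨key _ h.1.1, key _ h.1.2.1, key _ h.1.2.2.1, key _ h.1.2.2.2⟩

/-- The clique number is the largest size of a maximal clique. -/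
theorem cliqueNum_eq_sup_card {F : Finset (Finset V)}
    (hF : ∀ K : Finset V, K ∈ F ↔ Maximal G.IsClique (K : Set V)) :
    G.cliqueNum = F.sup Finset.card := by
  apply le_antisymm
  · obtain ⟨K, hK⟩ := G.exists_isNClique_cliqueNum
    obtain ⟨M, hKM, hM⟩ := Set.Finite.exists_le_maximal (Set.toFinite {K | G.IsClique K})
      (show (K : Set V) ∈ {K | G.IsClique K} from hK.isClique)
    classical
    have hM' : M.toFinset ∈ F := (hF _).2 (by simpa using hM)
    calc G.cliqueNum = K.card := hK.card_eq.symm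
      _ ≤ M.toFinset.card := Finset.card_le_card fun x hx => by
          simpa using hKM (by simpa using hx)
      _ ≤ _ := Finset.le_sup (f := Finset.card) hM'
  · exact Finset.sup_le fun K hK => ((hF K).1 hK).prop.card_le_cliqueNum

end SimpleGraph

/-- Two closed rectangles of unit height meet iff their sides overlap in both coordinates. -/
theorem stabRect_inter_nonempty_iff {l r b l' r' b' : ℝ} (h : l < r) (h' : l' < r') :
    (stabRect l r b ∩ stabRect l' r' b').Nonempty ↔
      l ≤ r' ∧ l' ≤ r ∧ b ≤ b' + 1 ∧ b' ≤ b + 1 := by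
  rw [stabRect, stabRect, Set.prod_inter_prod, Set.prod_nonempty_iff, Set.Icc_inter_Icc,
    Set.Icc_inter_Icc, Set.nonempty_Icc, Set.nonempty_Icc, sup_le_iff, le_inf_iff, le_inf_iff,
    sup_le_iff, le_inf_iff, le_inf_iff]
  constructor
  · rintro ⟨⟨⟨-, h1⟩, h2, -⟩, ⟨-, h3⟩, h4, -⟩
    exact ⟨h1, h2, h3, h4⟩
  · rintro ⟨h1, h2, h3, h4⟩
    exact ⟨⟨⟨h.le, h1⟩, h2, h'.le⟩, ⟨by linarith, h3⟩, h4, by linarith⟩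

/-- A maximal clique is the common closed neighbourhood of its members with the rightmost left
side, the leftmost right side, the highest bottom and the lowest bottom: by the Helly property of
rectangles, the intersection of these four is the intersection of the whole clique, and a rectangle
that meets all four meets this intersection. -/
theorem TwoStabRep.exists_isCliqueFrame {ε : ℝ} {V : Type*} [Fintype V] [Nonempty V]
    {G : SimpleGraph V} (R : TwoStabRep ε G) {K : Finset V}
    (hK : Maximal G.IsClique (K : Set V)) :
    ∃ q, G.IsCliqueFrame q ∧ K = G.commonNbhd q := by
  have hadj : ∀ u v, (u = v ∨ G.Adj u v) ↔ R.left u ≤ R.right v ∧ R.left v ≤ R.right u ∧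
      R.bottom u ≤ R.bottom v + 1 ∧ R.bottom v ≤ R.bottom u + 1 := by
    intro u v
    rw [R.adj_iff, stabRect_inter_nonempty_iff (R.left_lt_right u) (R.left_lt_right v)]
    have := R.left_lt_right u
    by_cases huv : u = v
    · subst huv
      simp [this.le]
    · simp [huv]
  have hcl : ∀ u ∈ K, ∀ v ∈ K, u = v ∨ G.Adj u v := fun u hu v hv =>
    or_iff_not_imp_left.2 fun hne => hK.prop hu hv hne
  have hne : K.Nonempty := by
    rw [Finset.nonempty_iff_ne_empty]
    rintro rfl
    obtain ⟨v⟩ := ‹Nonempty V›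
    have := hK.le_of_ge (y := {v}) (by simp) (by simp)
    simp at this
  -- All heights are `1`, so the lowest bottom also has the lowest top.
  obtain ⟨a, ha, ha'⟩ := K.exists_max_image R.left hne
  obtain ⟨b, hb, hb'⟩ := K.exists_min_image R.right hne
  obtain ⟨c, hc, hc'⟩ := K.exists_max_image R.bottom hne
  obtain ⟨d, hd, hd'⟩ := K.exists_min_image R.bottom hne
  have hS : K = G.commonNbhd (a, b, c, d) := by
    ext w
    simp only [SimpleGraph.commonNbhd, Finset.mem_filter, Finset.mem_univ, true_and]
    refine ⟨fun hw => ⟨hcl _ ha _ hw, hcl _ hb _ hw, hcl _ hc _ hw, hcl _ hd _ hw⟩, ?_⟩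
    rintro ⟨h1, h2, h3, h4⟩
    have hw : ∀ v ∈ K, w = v ∨ G.Adj w v := by
      intro v hv
      rw [hadj] at h1 h2 h3 h4 ⊢
      have := ha' v hv
      have := hb' v hv
      have := hc' v hv
      have := hd' v hv
      refine ⟨?_, ?_, ?_, ?_⟩ <;> linarith
    have hins : G.IsClique (insert w (K : Set V)) :=
      hK.prop.insert fun v hv hne => (hw v hv).resolve_left hne
    simpa using hK.le_of_ge hins (Set.subset_insert _ _) (Set.mem_insert _ _)
  refine ⟨(a, b, c, d), ⟨?_, ?_⟩, hS⟩
  · rw [← hS]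
    exact ⟨ha, hb, hc, hd⟩
  · rw [← hS]
    exact fun u v hu hv => hcl u hu v hv

/-! ### Running time and correctness of programs -/

namespace RAM

@[simp] theorem State.var_setVar (s : State) (x k y : ℕ) :
    (s.setVar x k).var y = if y = x then k else s.var y := by
  simp [State.setVar, Function.update_apply]

theorem State.var_setVar_self (s : State) (x k : ℕ) : (s.setVar x k).var x = k := by simp

theorem State.var_setVar_of_ne (s : State) {x y : ℕ} (k : ℕ) (h : y ≠ x) :
    (s.setVar x k).var y = s.var y := by simp [h]

@[simp] theorem State.arr_setVar (s : State) (x k : ℕ) : (s.setVar x k).arr = s.arr := rfl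

@[simp] theorem State.arr_setArr (s : State) (a i k b j : ℕ) :
    (s.setArr a i k).arr b j = if b = a ∧ j = i then k else s.arr b j := by
  by_cases h : b = a
  · subst h
    simp [State.setArr, Function.update_apply]
  · simp [State.setArr, h]

namespace Prog

/-- The program never assigns to the variable `x`. -/
def keepsVar (x : ℕ) : Prog → Bool
  | skip => true
  | assign y _ => x != y
  | write _ _ _ => true
  | seq P Q => P.keepsVar x && Q.keepsVar x
  | ite _ P Q => P.keepsVar x && Q.keepsVar x
  | loop _ P => P.keepsVar x

/-- The program never writes to the array `a`. -/
def keepsArr (a : ℕ) : Prog → Bool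
  | skip => true
  | assign _ _ => true
  | write b _ _ => a != b
  | seq P Q => P.keepsArr a && Q.keepsArr a
  | ite _ P Q => P.keepsArr a && Q.keepsArr a
  | loop _ P => P.keepsArr a

/-- The states `s` and `s'` agree on everything that the program `P` does not assign to. -/
structure Frame (P : Prog) (s s' : State) : Prop where
  var : ∀ x, P.keepsVar x = true → s'.var x = s.var x
  arr : ∀ a, P.keepsArr a = true → s'.arr a = s.arr a

theorem Frame.refl (P : Prog) (s : State) : P.Frame s s := ⟨fun _ _ => rfl, fun _ _ => rfl⟩

theorem Frame.trans {P : Prog} {s s' s'' : State} (h : P.Frame s s') (h' : P.Frame s' s'') :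
    P.Frame s s'' :=
  ⟨fun x hx => (h'.var x hx).trans (h.var x hx), fun a ha => (h'.arr a ha).trans (h.arr a ha)⟩

theorem Frame.mono {P Q : Prog} {s s' : State} (h : P.Frame s s')
    (hv : ∀ x, Q.keepsVar x = true → P.keepsVar x = true)
    (ha : ∀ a, Q.keepsArr a = true → P.keepsArr a = true) : Q.Frame s s' :=
  ⟨fun x hx => h.var x (hv x hx), fun a hx => h.arr a (ha a hx)⟩

theorem Runs.frame {P : Prog} {s s' : State} {t : ℕ} (h : P.Runs s s' t) : P.Frame s s' := by
  induction h with
  | skip s => exact Frame.refl _ _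
  | assign x e s => exact ⟨fun y hy => by simp_all [keepsVar], fun _ _ => rfl⟩
  | write a i e s =>
    exact ⟨fun _ _ => rfl, fun b hb => by ext j; simp_all [keepsArr]⟩
  | seq _ _ h₁ h₂ =>
    exact (h₁.mono (by simp +contextual [keepsVar]) (by simp +contextual [keepsArr])).trans
      (h₂.mono (by simp +contextual [keepsVar]) (by simp +contextual [keepsArr]))
  | ite_true _ _ h =>
    exact h.mono (by simp +contextual [keepsVar]) (by simp +contextual [keepsArr])
  | ite_false _ _ h =>
    exact h.mono (by simp +contextual [keepsVar]) (by simp +contextual [keepsArr])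
  | loop_true _ _ _ h₁ h₂ =>
    exact Frame.trans (P := loop _ _) (h₁.mono (fun _ h => h) fun _ h => h) h₂
  | loop_false _ => exact Frame.refl _ _

/-- Started in `s`, the program `P` halts after at most `T` steps in a state that satisfies `Q`. -/
def Ensures (P : Prog) (s : State) (T : ℕ) (Q : State → Prop) : Prop :=
  ∃ s' t, P.Runs s s' t ∧ t ≤ T ∧ Q s'

/-- A postcondition may be weakened with the help of the frame of the program. -/
theorem Ensures.imp {P : Prog} {s : State} {T T' : ℕ} {Q Q' : State → Prop}
    (h : P.Ensures s T Q) (hT : T ≤ T') (hQ : ∀ s', P.Frame s s' → Q s' → Q' s') :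
    P.Ensures s T' Q' := by
  obtain ⟨s', t, hr, ht, hq⟩ := h
  exact ⟨s', t, hr, ht.trans hT, hQ s' hr.frame hq⟩

theorem ensures_skip {s : State} {T : ℕ} {Q : State → Prop} (hT : 1 ≤ T) (h : Q s) :
    skip.Ensures s T Q := ⟨_, _, .skip s, hT, h⟩

theorem ensures_assign {x : ℕ} {e : Term} {s : State} {T : ℕ} {Q : State → Prop}
    (hT : e.cost + 1 ≤ T) (h : Q (s.setVar x (e.eval s))) : (assign x e).Ensures s T Q :=
  ⟨_, _, .assign x e s, hT, h⟩

theorem ensures_write {a : ℕ} {i e : Term} {s : State} {T : ℕ} {Q : State → Prop}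
    (hT : i.cost + e.cost + 1 ≤ T) (h : Q (s.setArr a (i.eval s) (e.eval s))) :
    (write a i e).Ensures s T Q :=
  ⟨_, _, .write a i e s, hT, h⟩

theorem Ensures.seq {P P' : Prog} {s : State} {T T' : ℕ} {Q Q' : State → Prop}
    (h : P.Ensures s T Q) (h' : ∀ s', P.Frame s s' → Q s' → P'.Ensures s' T' Q') :
    (P.seq P').Ensures s (T + T') Q' := by
  obtain ⟨s', t, hr, ht, hq⟩ := h
  obtain ⟨s'', t', hr', ht', hq'⟩ := h' s' hr.frame hq
  exact ⟨s'', _, hr.seq hr', by omega, hq'⟩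

theorem ensures_ite {c : Term} {P P' : Prog} {s : State} {T : ℕ} {Q : State → Prop}
    (h : c.eval s ≠ 0 → P.Ensures s T Q) (h' : c.eval s = 0 → P'.Ensures s T Q) :
    (ite c P P').Ensures s (c.cost + 1 + T) Q := by
  by_cases hc : c.eval s = 0
  · obtain ⟨s', t, hr, ht, hq⟩ := h' hc
    exact ⟨s', _, .ite_false hc hr, by omega, hq⟩
  · obtain ⟨s', t, hr, ht, hq⟩ := h hc
    exact ⟨s', _, .ite_true hc hr, by omega, hq⟩

/-- `for i := 0 to N - 1 do P`, where `N` names the variable that holds the bound. -/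
def forRange (i N : ℕ) (P : Prog) : Prog :=
  seq (assign i (.const 0))
    (loop (.lt (.var i) (.var N)) (seq P (assign i (.add (.var i) (.const 1)))))

theorem Frame.forRange {i N : ℕ} {P : Prog} {s s' : State} (h : P.Frame s s') :
    (forRange i N P).Frame s s' :=
  h.mono (by simp +contextual [Prog.forRange, keepsVar])
    (by simp +contextual [Prog.forRange, keepsArr])

theorem frame_forRange_setVar (i N : ℕ) (P : Prog) (s : State) (k : ℕ) :
    (forRange i N P).Frame s (s.setVar i k) :=
  ⟨by simp +contextual [Prog.forRange, keepsVar], fun _ _ => rfl⟩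

/-- The invariant rule for counting loops. The loop itself spends `8` steps on every pass, for its
test and for the increment of its variable, and `6` steps on the initialization and the last
test. -/
theorem ensures_forRange {i N : ℕ} {P : Prog} {s : State} {n T : ℕ} (I : ℕ → State → Prop)
    (hn : s.var N = n) (hN : (forRange i N P).keepsVar N = true) (hi : P.keepsVar i = true)
    (h0 : I 0 (s.setVar i 0))
    (step : ∀ k < n, ∀ s', (forRange i N P).Frame s s' → s'.var i = k → I k s' →
      P.Ensures s' T fun s'' => I (k + 1) (s''.setVar i (k + 1))) :
    (forRange i N P).Ensures s (n * (T + 8) + 6) (I n) := by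
  -- Induction on the number `j` of passes that remain.
  have main : ∀ j k s', j + k = n → (forRange i N P).Frame s s' → s'.var i = k → I k s' →
      (loop (.lt (.var i) (.var N)) (seq P (assign i (.add (.var i) (.const 1))))).Ensures s'
        (j * (T + 8) + 4) (I n) := by
    intro j
    induction j with
    | zero =>
      intro k s' hk hf hik hI
      obtain rfl : k = n := by omega
      refine ⟨s', _, .loop_false ?_, by simp [Term.cost], hI⟩
      simp [Term.eval, hik, hf.var _ hN, hn]
    | succ j ih =>
      intro k s' hk hf hik hI
      obtain ⟨s'', t, hr, ht, hq⟩ := step k (by omega) s' hf hik hI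
      have hk' : s''.var i = k := (hr.frame.var i hi).trans hik
      obtain ⟨s₃, t', hr', ht', hq'⟩ := ih (k + 1) (s''.setVar i (k + 1)) (by omega)
        ((hf.trans hr.frame.forRange).trans (frame_forRange_setVar ..)) (by simp) hq
      refine ⟨s₃, _, .loop_true ?_ (hr.seq (.assign ..)) (s'' := s₃) (t' := t') ?_, ?_, hq'⟩
      · simp [Term.eval, hik, hf.var _ hN, hn]
        omega
      · simpa [Term.eval, hk'] using hr'
      · simp only [Term.cost]
        linarith
  obtain ⟨s', t, hr, ht, hq⟩ :=
    main n 0 (s.setVar i 0) rfl (frame_forRange_setVar ..) (by simp) h0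
  exact ⟨s', _, (Runs.assign i (.const 0) s).seq hr, by simp only [Term.cost]; omega, hq⟩

end Prog

/-! ### The program -/

/-- Variable: the number of vertices. -/
def vN : ℕ := 0

/-- Variable: the number of vertex sets listed so far. -/
def vCount : ℕ := 1

/-- Variable: the largest size of a listed set. -/
def vBest : ℕ := 2

/-- Variable: the first vertex of the current quadruple. -/
def vA : ℕ := 3

/-- Variable: the second vertex of the current quadruple. -/
def vB : ℕ := 4

/-- Variable: the third vertex of the current quadruple. -/
def vC : ℕ := 5

/-- Variable: the fourth vertex of the current quadruple. -/
def vD : ℕ := 6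

/-- Variable: a running vertex. -/
def vW : ℕ := 7

/-- Variable: a second running vertex. -/
def vZ : ℕ := 8

/-- Variable: `1` as long as the current set has passed all tests, else `0`. -/
def vOk : ℕ := 9

/-- Variable: the first index of the current output row, the row after the listed ones. -/
def vOff : ℕ := 10

/-- Variable: the size of the current set. -/
def vSize : ℕ := 11

/-- Variable: the number of a running output row. -/
def vRow : ℕ := 12

/-- Variable: the first index of the running row. -/
def vRowOff : ℕ := 13

/-- Variable: `1` as long as the running row agrees with the current row, else `0`. -/
def vSame : ℕ := 14

/-- The `0`-`1`-valued test whether the vertices in the variables `x` and `y` are equal or adjacent.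
The sum of the two tests is at most `1`, as a vertex is not adjacent to itself. The array `3` holds
the multiples of the number of vertices, so that no multiplication is needed. -/
def closedAdj (x y : ℕ) : Term :=
  .add (.read 0 (.add (.read 3 (.var x)) (.var y))) (.eq (.var x) (.var y))

/-- The output entry of the vertex in the variable `w`, in the row with first index in `o`. -/
def entry (o w : ℕ) : Term := .read 2 (.add (.var o) (.var w))

/-- The sum of four terms. -/
def sumFour (e₁ e₂ e₃ e₄ : Term) : Term := .add (.add (.add e₁ e₂) e₃) e₄

/-- Tabulate the multiples of the number of vertices. -/
def initRows : Prog :=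
  (Prog.forRange vW vN
    ((Prog.write 3 (.var vW) (.var vOff)).seq (.assign vOff (.add (.var vOff) (.var vN))))).seq
    (.assign vOff (.const 0))

/-- Write the common closed neighbourhood of the four current vertices to the current row. -/
def fillRow : Prog :=
  .forRange vW vN (.write 2 (.add (.var vOff) (.var vW))
    (.eq (sumFour (closedAdj vA vW) (closedAdj vB vW) (closedAdj vC vW) (closedAdj vD vW))
      (.const 4)))

/-- Test whether the current row is a clique that contains the four current vertices. As `vOk` is
`0` or `1` and subtraction truncates, subtracting a test makes `vOk` zero, for good, as soon as the
test succeeds: here, for a pair of vertices in the row that are neither equal nor adjacent. -/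
def checkClique : Prog :=
  (Prog.assign vOk (.eq (sumFour (entry vOff vA) (entry vOff vB) (entry vOff vC) (entry vOff vD))
    (.const 4))).seq
    (.forRange vW vN (.forRange vZ vN (.assign vOk (.sub (.var vOk)
      (.eq (.add (.add (entry vOff vW) (entry vOff vZ)) (.sub (.const 1) (closedAdj vW vZ)))
        (.const 3))))))

/-- Reject the current row if it equals one of the rows listed before. -/
def checkNew : Prog :=
  (Prog.assign vRowOff (.const 0)).seq
    (.forRange vRow vCount
      ((Prog.assign vSame (.const 1)).seq
      ((Prog.forRange vW vN (.assign vSame (.sub (.var vSame)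
        (.sub (.const 1) (.eq (entry vRowOff vW) (entry vOff vW)))))).seq
      ((Prog.assign vOk (.sub (.var vOk) (.var vSame))).seq
      (.assign vRowOff (.add (.var vRowOff) (.var vN)))))))

/-- Keep the current row if it has passed the tests, and update the largest size. -/
def accept : Prog :=
  .ite (.var vOk)
    ((Prog.assign vSize (.const 0)).seq
    ((Prog.forRange vW vN (.assign vSize (.add (.var vSize) (entry vOff vW)))).seq
    ((Prog.ite (.lt (.var vBest) (.var vSize)) (.assign vBest (.var vSize)) .skip).seq
    ((Prog.assign vCount (.add (.var vCount) (.const 1))).seq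
    (.assign vOff (.add (.var vOff) (.var vN)))))))
    .skip

/-- Treat the four current vertices. -/
def treatFrame : Prog := fillRow.seq (checkClique.seq (checkNew.seq accept))

/-- List the common closed neighbourhoods of all quadruples of vertices that are cliques containing
their quadruple, without repetitions. The graph without vertices has the maximal clique `∅`, which
contains no quadruple. -/
def listCliques : Prog :=
  .ite (.var vN)
    (initRows.seq
      (.forRange vA vN (.forRange vB vN (.forRange vC vN (.forRange vD vN treatFrame)))))
    (.assign vCount (.const 1))

/-! ### Correctness of the parts of the program -/

section Indicator

variable (p q r : Prop) [Decidable p] [Decidable q] [Decidable r]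

theorem ite_sub_ite : ((if p then 1 else 0) - (if q then 1 else 0) : ℕ) =
    if p ∧ ¬ q then 1 else 0 := by
  split_ifs <;> simp_all

theorem one_sub_ite : (1 - (if p then 1 else 0) : ℕ) = if ¬ p then 1 else 0 := by
  split_ifs <;> simp_all

theorem ite_eq_ite_iff : (if p then 1 else 0 : ℕ) = (if q then 1 else 0) ↔ (p ↔ q) := by
  split_ifs <;> simp_all

theorem ite_add_ite_eq_three : (if p then 1 else 0) + (if q then 1 else 0) +
    (1 - (if r then 1 else 0) : ℕ) = 3 ↔ p ∧ q ∧ ¬ r := by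
  split_ifs <;> simp_all

end Indicator

section

variable {n : ℕ} {G : SimpleGraph (Fin n)}

open Classical in
/-- The input is in place and the multiples of `n` are tabulated. -/
structure Ready (G : SimpleGraph (Fin n)) (s : State) : Prop where
  n_eq : s.var vN = n
  adj : ∀ u v : Fin n, s.arr 0 (u * n + v) = if G.Adj u v then 1 else 0
  mul : ∀ u : Fin n, s.arr 3 u = u * n

theorem Ready.frame {P : Prog} {s s' : State} (h : Ready G s) (hf : P.Frame s s')
    (hn : P.keepsVar vN = true) (h0 : P.keepsArr 0 = true) (h3 : P.keepsArr 3 = true) :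
    Ready G s' :=
  ⟨by rw [hf.var _ hn, h.n_eq], by rw [hf.arr _ h0]; exact h.adj, by rw [hf.arr _ h3]; exact h.mul⟩

open Classical in
theorem Ready.eval_closedAdj {s : State} (h : Ready G s) {x y : ℕ} (u v : Fin n)
    (hx : s.var x = u) (hy : s.var y = v) :
    (closedAdj x y).eval s = if u = v ∨ G.Adj u v then 1 else 0 := by
  by_cases huv : u = v
  · subst huv
    simp [closedAdj, Term.eval, hx, hy, h.mul, h.adj]
  · simp [closedAdj, Term.eval, hx, hy, h.mul, h.adj, huv, Fin.val_inj]

/-- The output row with first index `o` is the characteristic vector of `K`. -/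
def HasRow (n : ℕ) (s : State) (o : ℕ) (K : Finset (Fin n)) : Prop :=
  ∀ v : Fin n, s.arr 2 (o + v) = if v ∈ K then 1 else 0

theorem HasRow.eval_entry {s : State} {o x w : ℕ} {K : Finset (Fin n)} (h : HasRow n s o K)
    (v : Fin n) (hx : s.var x = o) (hw : s.var w = v) :
    (entry x w).eval s = if v ∈ K then 1 else 0 := by
  simp [entry, Term.eval, hx, hw, h v]

theorem HasRow.frame {P : Prog} {s s' : State} {o : ℕ} {K : Finset (Fin n)} (h : HasRow n s o K)
    (hf : P.Frame s s') (h2 : P.keepsArr 2 = true) : HasRow n s' o K := by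
  intro v
  rw [hf.arr _ h2]
  exact h v

/-- The four current vertices are those of `q`. -/
structure AtFrame (q : Fin n × Fin n × Fin n × Fin n) (s : State) : Prop where
  a : s.var vA = q.1
  b : s.var vB = q.2.1
  c : s.var vC = q.2.2.1
  d : s.var vD = q.2.2.2

theorem AtFrame.frame {P : Prog} {s s' : State} {q : Fin n × Fin n × Fin n × Fin n}
    (h : AtFrame q s) (hf : P.Frame s s') (ha : P.keepsVar vA = true) (hb : P.keepsVar vB = true)
    (hc : P.keepsVar vC = true) (hd : P.keepsVar vD = true) : AtFrame q s' :=
  ⟨by rw [hf.var _ ha, h.a], by rw [hf.var _ hb, h.b], by rw [hf.var _ hc, h.c],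
    by rw [hf.var _ hd, h.d]⟩

/-- `fillRow` writes the common closed neighbourhood and leaves the rows before it alone. -/
theorem ensures_fillRow {s : State} {q : Fin n × Fin n × Fin n × Fin n} (hG : Ready G s)
    (hq : AtFrame q s) :
    fillRow.Ensures s (n * 58 + 6) fun s' =>
      HasRow n s' (s.var vOff) (G.commonNbhd q) ∧
      ∀ i < s.var vOff, s'.arr 2 i = s.arr 2 i := by
  have := Prog.ensures_forRange (i := vW) (N := vN) (s := s) (T := 50)
    (P := .write 2 (.add (.var vOff) (.var vW))
    (.eq (sumFour (closedAdj vA vW) (closedAdj vB vW) (closedAdj vC vW) (closedAdj vD vW))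
      (.const 4)))
    (fun k s' => (∀ v : Fin n, v < k →
        s'.arr 2 (s.var vOff + v) = if v ∈ G.commonNbhd q then 1 else 0) ∧
      ∀ i < s.var vOff, s'.arr 2 i = s.arr 2 i)
    hG.n_eq rfl rfl (by simp) (by
      intro k hk s' hf hw hI
      have hG' := hG.frame hf rfl rfl rfl
      have hq' := hq.frame hf rfl rfl rfl rfl
      have hoff : s'.var vOff = s.var vOff := hf.var _ rfl
      refine Prog.ensures_write (by decide) ⟨?_, ?_⟩
      · intro v hv
        have hval : (Term.eq (sumFour (closedAdj vA vW) (closedAdj vB vW) (closedAdj vC vW)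
            (closedAdj vD vW)) (.const 4)).eval s' = if ⟨k, hk⟩ ∈ G.commonNbhd q then 1 else 0 := by
          simp only [Term.eval, sumFour, hG'.eval_closedAdj _ ⟨k, hk⟩ hq'.a hw,
            hG'.eval_closedAdj _ ⟨k, hk⟩ hq'.b hw, hG'.eval_closedAdj _ ⟨k, hk⟩ hq'.c hw,
            hG'.eval_closedAdj _ ⟨k, hk⟩ hq'.d hw]
          simp only [SimpleGraph.commonNbhd, Finset.mem_filter, Finset.mem_univ, true_and]
          congr 1
          split_ifs <;> simp_all
        rw [State.arr_setVar, State.arr_setArr]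
        by_cases hvk : (v : ℕ) = k
        · obtain rfl : v = ⟨k, hk⟩ := Fin.ext hvk
          rw [if_pos ⟨rfl, by simp [Term.eval, hoff, hw]⟩, hval]
        · rw [if_neg, hI.1 v (by omega)]
          rintro ⟨-, h⟩
          simp only [Term.eval, hoff, hw] at h
          omega
      · intro i hi
        rw [State.arr_setVar, State.arr_setArr, if_neg, hI.2 i hi]
        rintro ⟨-, h⟩
        simp only [Term.eval, hoff, hw] at h
        omega)
  exact this.imp le_rfl fun s' _ h => ⟨fun v => h.1 v v.2, h.2⟩

open Classical in
theorem ensures_checkClique {s : State} {q : Fin n × Fin n × Fin n × Fin n} (hG : Ready G s)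
    (hq : AtFrame q s) (hrow : HasRow n s (s.var vOff) (G.commonNbhd q)) :
    checkClique.Ensures s (22 + (n * (n * 38 + 14) + 6)) fun s' =>
      s'.var vOk = if G.IsCliqueFrame q then 1 else 0 := by
  set S := G.commonNbhd q with hS
  refine Prog.Ensures.seq (Q := fun s' => s'.var vOk =
    if q.1 ∈ S ∧ q.2.1 ∈ S ∧ q.2.2.1 ∈ S ∧ q.2.2.2 ∈ S then 1 else 0)
    (Prog.ensures_assign (by decide) ?_) ?_
  · simp only [Term.eval, sumFour, hrow.eval_entry _ rfl hq.a, hrow.eval_entry _ rfl hq.b,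
      hrow.eval_entry _ rfl hq.c, hrow.eval_entry _ rfl hq.d, State.var_setVar, if_true]
    congr 1
    split_ifs <;> simp_all
  · intro s₁ hf₁ hok₁
    have hG₁ := hG.frame hf₁ rfl rfl rfl
    have hoff₁ : s₁.var vOff = s.var vOff := hf₁.var _ rfl
    have hrow₁ := hrow.frame hf₁ rfl
    rw [← hoff₁] at hrow₁
    refine (Prog.ensures_forRange (i := vW) (N := vN) (s := s₁) (T := n * 38 + 6)
      (fun k s' => s'.var vOk = if (q.1 ∈ S ∧ q.2.1 ∈ S ∧ q.2.2.1 ∈ S ∧ q.2.2.2 ∈ S) ∧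
        ∀ u v : Fin n, (u : ℕ) < k → u ∈ S → v ∈ S → u = v ∨ G.Adj u v then 1 else 0)
      hG₁.n_eq rfl rfl
      (by rw [State.var_setVar_of_ne _ _ (by decide)]; simpa using hok₁) ?_).imp le_rfl ?_
    · intro k hk s₂ hf₂ hw₂ hok₂
      have hG₂ := hG₁.frame hf₂ rfl rfl rfl
      have hoff₂ : s₂.var vOff = s₁.var vOff := hf₂.var _ rfl
      have hrow₂ := hrow₁.frame hf₂ rfl
      rw [← hoff₂] at hrow₂
      refine (Prog.ensures_forRange (i := vZ) (N := vN) (s := s₂) (T := 30)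
        (fun j s' => s'.var vOk = if (q.1 ∈ S ∧ q.2.1 ∈ S ∧ q.2.2.1 ∈ S ∧ q.2.2.2 ∈ S) ∧
          ∀ u v : Fin n, ((u : ℕ) < k ∨ (u : ℕ) = k ∧ (v : ℕ) < j) → u ∈ S → v ∈ S →
            u = v ∨ G.Adj u v then 1 else 0)
        hG₂.n_eq rfl rfl
        (by rw [State.var_setVar_of_ne _ _ (by decide)]; simpa using hok₂) ?_).imp le_rfl ?_
      · intro j hj s₃ hf₃ hz₃ hok₃
        have hG₃ := hG₂.frame hf₃ rfl rfl rfl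
        have hw₃ : s₃.var vW = k := (hf₃.var _ rfl).trans hw₂
        have hoff₃ : s₃.var vOff = s₂.var vOff := hf₃.var _ rfl
        have hrow₃ := hrow₂.frame hf₃ rfl
        rw [← hoff₃] at hrow₃
        refine Prog.ensures_assign (by decide) ?_
        have e₁ := hrow₃.eval_entry (w := vW) ⟨k, hk⟩ rfl hw₃
        have e₂ := hrow₃.eval_entry (w := vZ) ⟨j, hj⟩ rfl hz₃
        have e₃ := hG₃.eval_closedAdj ⟨k, hk⟩ ⟨j, hj⟩ hw₃ hz₃
        -- The pairs are tested in lexicographic order.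
        have hstep : (∀ u v : Fin n, ((u : ℕ) < k ∨ (u : ℕ) = k ∧ (v : ℕ) < j + 1) →
            u ∈ S → v ∈ S → u = v ∨ G.Adj u v) ↔
            (∀ u v : Fin n, ((u : ℕ) < k ∨ (u : ℕ) = k ∧ (v : ℕ) < j) → u ∈ S → v ∈ S →
            u = v ∨ G.Adj u v) ∧ ((⟨k, hk⟩ : Fin n) ∈ S → (⟨j, hj⟩ : Fin n) ∈ S →
              (⟨k, hk⟩ : Fin n) = ⟨j, hj⟩ ∨ G.Adj ⟨k, hk⟩ ⟨j, hj⟩) := by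
          constructor
          · exact fun h => ⟨fun u v huv => h u v (by omega),
              h _ _ (Or.inr ⟨rfl, Nat.lt_succ_self _⟩)⟩
          · rintro ⟨h, h'⟩ u v huv
            by_cases he : (u : ℕ) = k ∧ (v : ℕ) = j
            · obtain rfl : u = ⟨k, hk⟩ := Fin.ext he.1
              obtain rfl : v = ⟨j, hj⟩ := Fin.ext he.2
              exact h'
            · exact h u v (by omega)
        rw [State.var_setVar_of_ne _ _ (by decide), State.var_setVar_self]
        simp only [hstep, ← and_assoc, Term.eval, e₁, e₂, e₃, hok₃, ite_sub_ite]
        congr 2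
        rw [ite_add_ite_eq_three, not_and, not_and, not_not]
      · intro s' _ h
        simp only [State.var_setVar]
        rw [if_neg (by decide), h]
        congr 3
        simp only [eq_iff_iff]
        exact forall₂_congr fun u v => by
          rw [show ((u : ℕ) < k ∨ (u : ℕ) = k ∧ (v : ℕ) < n) ↔ (u : ℕ) < k + 1 by omega]
    · intro s' _ h
      rw [h]
      congr 2
      simp [← hS]

/-- The listed rows are those of the list `L`, and the current row is the next one. -/
structure HasRows (s : State) (L : List (Finset (Fin n))) : Prop where
  count : s.var vCount = L.length
  off : s.var vOff = L.length * n
  row : ∀ k (h : k < L.length), HasRow n s (k * n) L[k]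

/-- `checkNew` takes the conjunction of the tests passed so far, `p`, with the novelty of the
current set. -/
theorem ensures_checkNew {s : State} {L : List (Finset (Fin n))} {S : Finset (Fin n)}
    (hG : Ready G s) (hL : HasRows s L) (hrow : HasRow n s (s.var vOff) S) {p : Prop} [Decidable p]
    (hp : s.var vOk = if p then 1 else 0) :
    checkNew.Ensures s (2 + (L.length * (n * 28 + 24) + 6)) fun s' =>
      s'.var vOk = if p ∧ S ∉ L then 1 else 0 := by
  classical
  refine Prog.Ensures.seq (Q := fun s' => s'.var vRowOff = 0 * n)
    (Prog.ensures_assign (by decide) (by simp [Term.eval])) ?_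
  intro s₁ hf₁ hro₁
  have hG₁ := hG.frame hf₁ rfl rfl rfl
  have hok₁ : s₁.var vOk = s.var vOk := hf₁.var _ rfl
  have hoff₁ : s₁.var vOff = s.var vOff := hf₁.var _ rfl
  have hc₁ : s₁.var vCount = s.var vCount := hf₁.var _ rfl
  refine (Prog.ensures_forRange (i := vRow) (N := vCount) (s := s₁) (n := L.length)
    (T := n * 28 + 16)
    (fun k s' => s'.var vRowOff = k * n ∧ s'.var vOk = if p ∧ S ∉ L.take k then 1 else 0)
    (hc₁.trans hL.count) rfl rfl ⟨hro₁, by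
      rw [State.var_setVar_of_ne _ _ (by decide), hok₁]; simpa using hp⟩ ?_).imp le_rfl ?_
  · intro k hk s₂ hf₂ hk₂ ⟨hro₂, hok₂⟩
    have hG₂ := hG₁.frame hf₂ rfl rfl rfl
    have hoff₂ : s₂.var vOff = s.var vOff := (hf₂.var _ rfl).trans hoff₁
    have hrow₂ := (hrow.frame hf₁ rfl).frame hf₂ rfl
    have hrowk₂ := ((hL.row k hk).frame hf₁ rfl).frame hf₂ rfl
    rw [show n * 28 + 16 = 2 + (n * 28 + 6 + (4 + 4)) by ring]
    refine Prog.Ensures.seq (Q := fun s' => s'.var vSame = 1)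
      (Prog.ensures_assign (by decide) (by simp [Term.eval])) ?_
    intro s₃ hf₃ hsame₃
    have hoff₃ : s₃.var vOff = s.var vOff := (hf₃.var _ rfl).trans hoff₂
    have hro₃ : s₃.var vRowOff = k * n := (hf₃.var _ rfl).trans hro₂
    have hok₃ : s₃.var vOk = s₂.var vOk := hf₃.var _ rfl
    have hG₃ := hG₂.frame hf₃ rfl rfl rfl
    have hrow₃ := hrow₂.frame hf₃ rfl
    have hrowk₃ := hrowk₂.frame hf₃ rfl
    refine Prog.Ensures.seq (Q := fun s' => s'.var vSame = if S = L[k] then 1 else 0) ?_ ?_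
    · refine (Prog.ensures_forRange (i := vW) (N := vN) (s := s₃) (T := 20)
        (fun j s' => s'.var vSame =
          if ∀ v : Fin n, (v : ℕ) < j → (v ∈ L[k] ↔ v ∈ S) then 1 else 0)
        hG₃.n_eq rfl rfl
        (by rw [State.var_setVar_of_ne _ _ (by decide)]; simpa using hsame₃) ?_).imp le_rfl ?_
      · intro j hj s₄ hf₄ hw₄ hs₄
        have hoff₄ : s₄.var vOff = s.var vOff := (hf₄.var _ rfl).trans hoff₃
        have hro₄ : s₄.var vRowOff = k * n := (hf₄.var _ rfl).trans hro₃
        have e₁ := (hrow₃.frame hf₄ rfl).eval_entry (w := vW) ⟨j, hj⟩ hoff₄ hw₄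
        have e₂ := (hrowk₃.frame hf₄ rfl).eval_entry (w := vW) ⟨j, hj⟩ hro₄ hw₄
        refine Prog.ensures_assign (by decide) ?_
        have hstep : (∀ v : Fin n, (v : ℕ) < j + 1 → (v ∈ L[k] ↔ v ∈ S)) ↔
            (∀ v : Fin n, (v : ℕ) < j → (v ∈ L[k] ↔ v ∈ S)) ∧
              ((⟨j, hj⟩ : Fin n) ∈ L[k] ↔ (⟨j, hj⟩ : Fin n) ∈ S) := by
          constructor
          · exact fun h => ⟨fun v hv => h v (by omega), h ⟨j, hj⟩ (Nat.lt_succ_self _)⟩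
          · rintro ⟨h, h'⟩ v hv
            by_cases he : (v : ℕ) = j
            · obtain rfl : v = ⟨j, hj⟩ := Fin.ext he
              exact h'
            · exact h v (by omega)
        rw [State.var_setVar_of_ne _ _ (by decide), State.var_setVar_self]
        simp only [hstep, Term.eval, e₁, e₂, hs₄, one_sub_ite, ite_sub_ite, ite_eq_ite_iff, not_not]
      · intro s' _ h
        rw [h]
        congr 1
        simp [Finset.ext_iff, iff_comm]
    · intro s₄ hf₄ hs₄
      have hro₄ : s₄.var vRowOff = k * n := (hf₄.var _ rfl).trans hro₃
      have hok₄ : s₄.var vOk = s₂.var vOk := (hf₄.var _ rfl).trans hok₃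
      have hG₄ := hG₃.frame hf₄ rfl rfl rfl
      refine Prog.Ensures.seq (Q := fun s' => s'.var vOk =
        if p ∧ S ∉ L.take (k + 1) then 1 else 0) (Prog.ensures_assign (by decide) ?_) ?_
      · simp only [Term.eval, hok₄, hok₂, hs₄, State.var_setVar, if_true,
          List.take_succ_eq_append_getElem hk, List.mem_append, List.mem_singleton]
        split_ifs <;> simp_all
      · intro s₅ hf₅ hok₅
        have hro₅ : s₅.var vRowOff = k * n := (hf₅.var _ rfl).trans hro₄
        have hG₅ := hG₄.frame hf₅ rfl rfl rfl
        refine Prog.ensures_assign (by decide) ?_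
        rw [State.var_setVar_of_ne _ _ (by decide), State.var_setVar_self,
          State.var_setVar_of_ne _ _ (by decide), State.var_setVar_of_ne _ _ (by decide)]
        exact ⟨by rw [Term.eval, Term.eval, Term.eval, hro₅, hG₅.n_eq, add_mul, one_mul], hok₅⟩
  · intro s' _ h
    simpa using h.2

/-- The output consists of the list `L` and the largest size of its members. -/
structure HasOutput (s : State) (L : List (Finset (Fin n))) : Prop extends HasRows s L where
  best : s.var vBest = L.toFinset.sup Finset.card

theorem HasRows.outputList_eq {s : State} {L : List (Finset (Fin n))} (h : HasRows s L) :
    outputList n s = L := by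
  apply List.ext_getElem
  · rw [outputList, List.length_map, List.length_range]
    exact h.count
  · intro k hk hk'
    ext v
    simp [outputList, outputSet, h.row k hk' v]

theorem HasOutput.frame {P : Prog} {s s' : State} {L : List (Finset (Fin n))} (h : HasOutput s L)
    (hf : P.Frame s s') (hc : P.keepsVar vCount = true) (hb : P.keepsVar vBest = true)
    (ho : P.keepsVar vOff = true) (h2 : P.keepsArr 2 = true) : HasOutput s' L :=
  ⟨⟨(hf.var _ hc).trans h.count, (hf.var _ ho).trans h.off, fun k hk => (h.row k hk).frame hf h2⟩,
    (hf.var _ hb).trans h.best⟩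

theorem ensures_accept {s : State} {L : List (Finset (Fin n))} {S : Finset (Fin n)}
    (hG : Ready G s) (hL : HasOutput s L) (hrow : HasRow n s (s.var vOff) S) {p : Prop}
    [Decidable p] (hp : s.var vOk = if p then 1 else 0) :
    accept.Ensures s (n * 15 + 30) fun s' => HasOutput s' (if p then L ++ [S] else L) := by
  refine (Prog.ensures_ite (T := 2 + (n * 15 + 6 + (6 + (4 + 4)))) ?_ ?_).imp
    (by simp only [Term.cost]; omega) (fun _ _ h => h)
  · intro hc
    have hp' : p := by
      by_contra h
      exact hc (by simpa [Term.eval, h] using hp)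
    rw [if_pos hp']
    refine Prog.Ensures.seq (Q := fun s' => s'.var vSize = 0)
      (Prog.ensures_assign (by decide) (by simp [Term.eval])) ?_
    intro s₁ hf₁ hs₁
    have hG₁ := hG.frame hf₁ rfl rfl rfl
    have hrow₁ := hrow.frame hf₁ rfl
    have hoff₁ : s₁.var vOff = s.var vOff := hf₁.var _ rfl
    refine Prog.Ensures.seq (Q := fun s' => s'.var vSize = S.card) ?_ ?_
    · refine (Prog.ensures_forRange (i := vW) (N := vN) (s := s₁) (T := 7)
        (fun k s' => s'.var vSize = (S.filter fun v : Fin n => (v : ℕ) < k).card)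
        hG₁.n_eq rfl rfl
        (by rw [State.var_setVar_of_ne _ _ (by decide)]; simpa using hs₁) ?_).imp le_rfl ?_
      · intro k hk s₂ hf₂ hw₂ hs₂
        have hoff₂ : s₂.var vOff = s.var vOff := (hf₂.var _ rfl).trans hoff₁
        have e := (hrow₁.frame hf₂ rfl).eval_entry (w := vW) ⟨k, hk⟩ hoff₂ hw₂
        refine Prog.ensures_assign (by decide) ?_
        have hstep : (S.filter fun v : Fin n => (v : ℕ) < k + 1) =
            (S.filter fun v : Fin n => (v : ℕ) < k) ∪ (S.filter fun v => v = ⟨k, hk⟩) := by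
          rw [← Finset.filter_or]
          refine Finset.filter_congr fun v _ => ?_
          rw [Fin.ext_iff]
          exact Nat.lt_succ_iff_lt_or_eq
        rw [hstep, Finset.card_union_of_disjoint, Finset.filter_eq']
        · rw [State.var_setVar_of_ne _ _ (by decide), State.var_setVar_self]
          simp only [Term.eval, e, hs₂]
          split_ifs <;> simp
        · rw [Finset.disjoint_filter]
          rintro v - hv rfl
          simp at hv
      · intro s' _ h
        simpa using h
    · intro s₂ hf₂ hs₂
      have hbest₂ : s₂.var vBest = s.var vBest := (hf₂.var _ rfl).trans (hf₁.var _ rfl)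
      refine Prog.Ensures.seq (Q := fun s' => s'.var vBest = (L ++ [S]).toFinset.sup Finset.card)
        ((Prog.ensures_ite (T := 2) ?_ ?_).imp (by decide) (fun _ _ h => h)) ?_
      · intro hlt
        simp only [Term.eval, hs₂, hbest₂, hL.best] at hlt
        refine Prog.ensures_assign (by decide) ?_
        simp only [Term.eval, hs₂, State.var_setVar, if_true, List.toFinset_append,
          Finset.sup_union]
        have hle : L.toFinset.sup Finset.card ≤ S.card := by
          by_contra h
          exact hlt (if_neg fun h' => h h'.le)
        simpa using hle
      · intro hlt
        simp only [Term.eval, hs₂, hbest₂, hL.best] at hlt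
        refine Prog.ensures_skip (by decide) ?_
        simp only [hbest₂, hL.best, List.toFinset_append, Finset.sup_union]
        simp at hlt ⊢
        omega
      · intro s₃ hf₃ hbest₃
        refine Prog.Ensures.seq (Q := fun s' => s'.var vCount = (L ++ [S]).length)
          (Prog.ensures_assign (by decide) ?_) ?_
        · have hc₃ : s₃.var vCount = L.length :=
            (hf₃.var _ rfl).trans ((hf₂.var _ rfl).trans ((hf₁.var _ rfl).trans hL.count))
          simp only [Term.eval, hc₃, State.var_setVar, if_true]
          simp
        · intro s₄ hf₄ hc₄
          have hbest₄ : s₄.var vBest = s₃.var vBest := hf₄.var _ rfl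
          have hoff₄ : s₄.var vOff = s.var vOff :=
            (hf₄.var _ rfl).trans ((hf₃.var _ rfl).trans ((hf₂.var _ rfl).trans hoff₁))
          have hn₄ : s₄.var vN = n :=
            (hf₄.var _ rfl).trans ((hf₃.var _ rfl).trans ((hf₂.var _ rfl).trans hG₁.n_eq))
          refine Prog.ensures_assign (by decide) ⟨⟨?_, ?_, ?_⟩, ?_⟩
          · rw [State.var_setVar_of_ne _ _ (by decide), hc₄]
          · simp only [Term.eval, hoff₄, hn₄, hL.off, State.var_setVar, if_true]
            simp [add_mul]
          · have hr : ∀ {o K}, HasRow n s o K → HasRow n s₄ o K := fun h =>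
              (((h.frame hf₁ rfl).frame hf₂ rfl).frame hf₃ rfl).frame hf₄ rfl
            intro k hk
            by_cases hkL : k < L.length
            · rw [List.getElem_append_left hkL]
              exact hr (hL.row k hkL)
            · obtain rfl : k = L.length := by simp at hk; omega
              rw [← hL.off]
              rw [List.getElem_concat_length]
              · exact hr hrow
              · rfl
          · rw [State.var_setVar_of_ne _ _ (by decide), hbest₄, hbest₃]
  · intro hc
    have hp' : ¬ p := by
      intro h
      simp [show s.var vOk = 0 from hc, h] at hp
    rw [if_neg hp']
    exact Prog.ensures_skip (by omega) hL

open Classical in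
theorem ensures_initRows {s : State} (hn : s.var vN = n) (hoff : s.var vOff = 0)
    (hadj : ∀ u v : Fin n, s.arr 0 (u * n + v) = if G.Adj u v then 1 else 0) :
    initRows.Ensures s (n * 15 + 6 + 2) fun s' => Ready G s' ∧ s'.var vOff = 0 := by
  refine Prog.Ensures.seq (Q := fun s' => Ready G s') ?_ fun s' _ h =>
    Prog.ensures_assign (by decide) ⟨⟨?_, h.adj, h.mul⟩, State.var_setVar_self ..⟩
  · refine (Prog.ensures_forRange (i := vW) (N := vN) (s := s) (T := 7)
      (fun k s' => s'.var vOff = k * n ∧ ∀ u < k, s'.arr 3 u = u * n) hn rfl rfl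
      ⟨by rw [State.var_setVar_of_ne _ _ (by decide), hoff, zero_mul], by simp⟩ ?_).imp le_rfl ?_
    · rintro k hk s₁ hf₁ hw₁ ⟨hoff₁, hmul₁⟩
      refine Prog.Ensures.seq (T := 3) (T' := 4)
        (Q := fun s' => s'.var vOff = k * n ∧ ∀ u < k + 1, s'.arr 3 u = u * n)
        (Prog.ensures_write (by decide) ⟨hoff₁, fun u hu => ?_⟩) ?_
      · rw [State.arr_setArr]
        simp only [Term.eval, hw₁, hoff₁, true_and]
        split_ifs with h
        · rw [h]
        · exact hmul₁ u (by omega)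
      · rintro s₂ hf₂ ⟨hoff₂, hmul₂⟩
        refine Prog.ensures_assign (by decide) ⟨?_, hmul₂⟩
        have hn₂ : s₂.var vN = n := (hf₂.var _ rfl).trans ((hf₁.var _ rfl).trans hn)
        rw [State.var_setVar_of_ne _ _ (by decide), State.var_setVar_self, Term.eval, Term.eval,
          Term.eval, hoff₂, hn₂, add_mul, one_mul]
    · intro s' hf h
      exact ⟨(hf.var _ rfl).trans hn, by rw [hf.arr _ rfl]; exact hadj, fun u => h.2 u u.2⟩
  · rw [State.var_setVar_of_ne _ _ (by decide), h.n_eq]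

/-! ### Correctness of the main loops -/

/-- The list `L` consists, without repetitions, of the common closed neighbourhoods of those
quadruples in `D` that are frames of cliques. -/
structure Lists (G : SimpleGraph (Fin n)) (D : Set (Fin n × Fin n × Fin n × Fin n))
    (L : List (Finset (Fin n))) : Prop where
  nodup : L.Nodup
  mem_iff : ∀ K, K ∈ L ↔ ∃ q ∈ D, G.IsCliqueFrame q ∧ K = G.commonNbhd q

/-- There are at most as many listed sets as quadruples. -/
theorem Lists.length_le {D : Set (Fin n × Fin n × Fin n × Fin n)} {L : List (Finset (Fin n))}
    (h : Lists G D L) : L.length ≤ n ^ 4 := by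
  classical
  have hsub : L.toFinset ⊆ Finset.univ.image G.commonNbhd := by
    intro K hK
    obtain ⟨q, -, -, rfl⟩ := (h.mem_iff K).1 (List.mem_toFinset.1 hK)
    exact Finset.mem_image_of_mem _ (Finset.mem_univ q)
  rw [← List.toFinset_card_of_nodup h.nodup]
  refine (Finset.card_le_card hsub).trans (Finset.card_image_le.trans ?_)
  simp only [Finset.card_univ, Fintype.card_prod, Fintype.card_fin]
  exact le_of_eq (by ring)

open Classical in
/-- The effect of one quadruple on the list. -/
theorem Lists.insert {D : Set (Fin n × Fin n × Fin n × Fin n)} {L : List (Finset (Fin n))}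
    (h : Lists G D L) (q : Fin n × Fin n × Fin n × Fin n) :
    Lists G (D ∪ {q}) (if G.IsCliqueFrame q ∧ G.commonNbhd q ∉ L then L ++ [G.commonNbhd q]
      else L) := by
  split_ifs with hq
  · refine ⟨h.nodup.append (List.nodup_singleton _) (by simpa using hq.2), fun K => ?_⟩
    rw [List.mem_append, List.mem_singleton, h.mem_iff]
    constructor
    · rintro (⟨r, hr, h'⟩ | rfl)
      · exact ⟨r, Or.inl hr, h'⟩
      · exact ⟨q, Or.inr rfl, hq.1, rfl⟩
    · rintro ⟨r, hr | rfl, h'⟩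
      · exact Or.inl ⟨r, hr, h'⟩
      · exact Or.inr h'.2
  · refine ⟨h.nodup, fun K => ⟨fun hK => ?_, ?_⟩⟩
    · obtain ⟨r, hr, h'⟩ := (h.mem_iff K).1 hK
      exact ⟨r, Or.inl hr, h'⟩
    · rintro ⟨r, hr | rfl, h'⟩
      · exact (h.mem_iff K).2 ⟨r, hr, h'⟩
      · rw [h'.2]
        by_contra hK
        exact hq ⟨h'.1, hK⟩

/-- The invariant of the main loops: the output is correct for the quadruples in `D`. -/
def Listed (G : SimpleGraph (Fin n)) (D : Set (Fin n × Fin n × Fin n × Fin n)) (s : State) :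
    Prop :=
  Ready G s ∧ ∃ L, Lists G D L ∧ HasOutput s L

theorem Listed.setVar {D : Set (Fin n × Fin n × Fin n × Fin n)} {s : State} (h : Listed G D s)
    {x : ℕ} (k : ℕ) (hn : vN ≠ x) (hc : vCount ≠ x) (hb : vBest ≠ x) (ho : vOff ≠ x) :
    Listed G D (s.setVar x k) := by
  obtain ⟨hG, L, hL, hs⟩ := h
  refine ⟨⟨?_, hG.adj, hG.mul⟩, L, hL, ⟨?_, ?_, hs.row⟩, ?_⟩
  · rw [State.var_setVar_of_ne _ _ hn, hG.n_eq]
  · rw [State.var_setVar_of_ne _ _ hc, hs.count]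
  · rw [State.var_setVar_of_ne _ _ ho, hs.off]
  · rw [State.var_setVar_of_ne _ _ hb, hs.best]

/-- A time bound for the treatment of one quadruple, with one summand for each of the four parts of
`treatFrame`. At most `n ^ 4` sets are compared with the current one. -/
def frameTime (n : ℕ) : ℕ :=
  (n * 58 + 6) + ((22 + (n * (n * 38 + 14) + 6)) + ((2 + (n ^ 4 * (n * 28 + 24) + 6)) +
    (n * 15 + 30)))

theorem ensures_treatFrame {D : Set (Fin n × Fin n × Fin n × Fin n)} {s : State}
    {q : Fin n × Fin n × Fin n × Fin n} (h : Listed G D s) (hq : AtFrame q s) :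
    treatFrame.Ensures s (frameTime n) (Listed G (D ∪ {q})) := by
  classical
  obtain ⟨hG, L, hL, hs⟩ := h
  refine Prog.Ensures.imp (T := frameTime n)
    (Q := fun s' => HasOutput s' (if G.IsCliqueFrame q ∧ G.commonNbhd q ∉ L
      then L ++ [G.commonNbhd q] else L)) ?_ le_rfl
    fun s' hf h => ⟨hG.frame hf rfl rfl rfl, _, hL.insert q, h⟩
  refine (ensures_fillRow hG hq).seq ?_
  rintro s₁ hf₁ ⟨hrow₁, hold₁⟩
  have hG₁ := hG.frame hf₁ rfl rfl rfl
  have hoff₁ : s₁.var vOff = s.var vOff := hf₁.var _ rfl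
  have hs₁ : HasOutput s₁ L := by
    refine ⟨⟨(hf₁.var _ rfl).trans hs.count, hoff₁.trans hs.off, fun k hk v => ?_⟩,
      (hf₁.var _ rfl).trans hs.best⟩
    -- The current row starts after the rows that are listed already.
    rw [hold₁, hs.row k hk]
    calc k * n + v < (k + 1) * n := by rw [add_mul, one_mul]; omega
      _ ≤ L.length * n := Nat.mul_le_mul_right n hk
      _ = s.var vOff := hs.off.symm
  rw [← hoff₁] at hrow₁
  refine (ensures_checkClique hG₁ (hq.frame hf₁ rfl rfl rfl rfl) hrow₁).seq ?_
  intro s₂ hf₂ hok₂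
  have hG₂ := hG₁.frame hf₂ rfl rfl rfl
  have hoff₂ : s₂.var vOff = s₁.var vOff := hf₂.var _ rfl
  have hs₂ := hs₁.frame hf₂ rfl rfl rfl rfl
  have hrow₂ := hrow₁.frame hf₂ rfl
  rw [← hoff₂] at hrow₂
  refine Prog.Ensures.seq ((ensures_checkNew hG₂ hs₂.toHasRows hrow₂ hok₂).imp
    (T' := 2 + (n ^ 4 * (n * 28 + 24) + 6)) ?_ fun _ _ h => h) ?_
  · have := Nat.mul_le_mul_right (n * 28 + 24) hL.length_le
    omega
  intro s₃ hf₃ hok₃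
  have hoff₃ : s₃.var vOff = s₂.var vOff := hf₃.var _ rfl
  have hrow₃ := hrow₂.frame hf₃ rfl
  rw [← hoff₃] at hrow₃
  exact ensures_accept (hG₂.frame hf₃ rfl rfl rfl) (hs₂.frame hf₃ rfl rfl rfl rfl) hrow₃ hok₃

/-- A loop over all vertices whose passes treat the quadruples in `X 0`, `X 1`, … treats those in
the union of all `X k`. -/
theorem ensures_forRange_listed {i T : ℕ} {P : Prog} {s : State}
    {D : Set (Fin n × Fin n × Fin n × Fin n)} (X : Fin n → Set (Fin n × Fin n × Fin n × Fin n))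
    (hN : (Prog.forRange i vN P).keepsVar vN = true) (hi : P.keepsVar i = true)
    (hc : vCount ≠ i) (hb : vBest ≠ i) (ho : vOff ≠ i) (h : Listed G D s)
    (step : ∀ (k : Fin n) (s' : State) D, (Prog.forRange i vN P).Frame s s' → s'.var i = k →
      Listed G D s' → P.Ensures s' T (Listed G (D ∪ X k))) :
    (Prog.forRange i vN P).Ensures s (n * (T + 8) + 6) (Listed G (D ∪ ⋃ k, X k)) := by
  have hn : vN ≠ i := by
    simp only [Prog.forRange, Prog.keepsVar, Bool.and_eq_true, bne_iff_ne] at hN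
    exact hN.1
  refine (Prog.ensures_forRange (i := i) (N := vN) (s := s) (T := T)
    (fun k s' => Listed G (D ∪ ⋃ (j : Fin n) (_ : (j : ℕ) < k), X j) s') h.1.n_eq hN hi
    ?_ ?_).imp le_rfl ?_
  · simpa using h.setVar 0 hn hc hb ho
  · intro k hk s' hf hik hI
    refine (step ⟨k, hk⟩ s' _ hf hik hI).imp le_rfl fun s'' _ h' => ?_
    convert h'.setVar (k + 1) hn hc hb ho using 1
    rw [Set.union_assoc]
    congr 1
    ext q
    simp only [Set.mem_iUnion, Set.mem_union, exists_prop]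
    constructor
    · rintro ⟨j, hj, hq⟩
      by_cases he : (j : ℕ) = k
      · obtain rfl : j = ⟨k, hk⟩ := Fin.ext he
        exact Or.inr hq
      · exact Or.inl ⟨j, by omega, hq⟩
    · rintro (⟨j, hj, hq⟩ | hq)
      · exact ⟨j, by omega, hq⟩
      · exact ⟨⟨k, hk⟩, Nat.lt_succ_self k, hq⟩
  · intro s' _ h'
    simpa using h'

/-- A time bound for the main loops, in terms of the time `T` for one quadruple. -/
def loopsTime (n T : ℕ) : ℕ :=
  n * ((n * ((n * ((n * (T + 8) + 6) + 8) + 6) + 8) + 6) + 8) + 6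

theorem ensures_loops {s : State} (h : Listed G ∅ s) :
    (Prog.forRange vA vN (.forRange vB vN (.forRange vC vN (.forRange vD vN treatFrame)))).Ensures
      s (loopsTime n (frameTime n)) (Listed G Set.univ) := by
  refine (ensures_forRange_listed (fun a => ⋃ b, ⋃ c, ⋃ d, {(a, b, c, d)}) rfl rfl
    (by decide) (by decide) (by decide) h ?_).imp le_rfl ?_
  · intro a s₁ D₁ _ ha₁ h₁
    refine ensures_forRange_listed (fun b => ⋃ c, ⋃ d, {(a, b, c, d)}) rfl rfl
      (by decide) (by decide) (by decide) h₁ ?_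
    intro b s₂ D₂ hf₂ hb₂ h₂
    have ha₂ : s₂.var vA = a := (hf₂.var _ rfl).trans ha₁
    refine ensures_forRange_listed (fun c => ⋃ d, {(a, b, c, d)}) rfl rfl
      (by decide) (by decide) (by decide) h₂ ?_
    intro c s₃ D₃ hf₃ hc₃ h₃
    have ha₃ : s₃.var vA = a := (hf₃.var _ rfl).trans ha₂
    have hb₃ : s₃.var vB = b := (hf₃.var _ rfl).trans hb₂
    refine ensures_forRange_listed (fun d => {(a, b, c, d)}) rfl rfl
      (by decide) (by decide) (by decide) h₃ ?_
    intro d s₄ D₄ hf₄ hd₄ h₄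
    exact ensures_treatFrame h₄ ⟨(hf₄.var _ rfl).trans ha₃, (hf₄.var _ rfl).trans hb₃,
      (hf₄.var _ rfl).trans hc₃, hd₄⟩
  · intro s' _ h'
    convert h' using 1
    ext ⟨a, b, c, d⟩
    simp

open Classical in
/-- The entries of the adjacency matrix, by uniqueness of division with remainder. -/
theorem input_adj (V₁ : Set (Fin n)) (u v : Fin n) :
    (input G V₁).arr 0 (u * n + v) = if G.Adj u v then 1 else 0 := by
  have key : (∃ u' v' : Fin n, G.Adj u' v' ∧ (u * n + v : ℕ) = u' * n + v') ↔ G.Adj u v := by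
    refine ⟨?_, fun h => ⟨u, v, h, rfl⟩⟩
    rintro ⟨u', v', h, he⟩
    have hpos : 0 < n := u.pos
    have hv : (v : ℕ) = v' := by
      have := congrArg (· % n) he
      simpa [Nat.mul_add_mod_of_lt v.2, Nat.mul_add_mod_of_lt v'.2, Nat.mul_comm,
        Nat.mod_eq_of_lt v.2, Nat.mod_eq_of_lt v'.2] using this
    have hu : (u : ℕ) = u' := Nat.eq_of_mul_eq_mul_right hpos (by omega)
    obtain rfl := Fin.ext hu
    obtain rfl := Fin.ext hv
    exact h
  simp [input, key]

/-- The program lists the maximal cliques of every graph in which each of them is the common closed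
neighbourhood of a frame. -/
theorem ensures_listCliques (V₁ : Set (Fin n))
    (hG : 0 < n → ∀ K : Finset (Fin n), Maximal G.IsClique (K : Set (Fin n)) →
      ∃ q, G.IsCliqueFrame q ∧ K = G.commonNbhd q) :
    listCliques.Ensures (input G V₁) (n * 15 + loopsTime n (frameTime n) + 10) fun s =>
      (outputList n s).Nodup ∧
      (∀ K : Finset (Fin n), K ∈ outputList n s ↔ Maximal G.IsClique (K : Set (Fin n))) ∧
      outputNumber s = G.cliqueNum := by
  have hbest : ∀ L : List (Finset (Fin n)),
      (∀ K : Finset (Fin n), K ∈ L ↔ Maximal G.IsClique (K : Set (Fin n))) →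
      G.cliqueNum = L.toFinset.sup Finset.card := fun L hL =>
    SimpleGraph.cliqueNum_eq_sup_card fun K => by rw [List.mem_toFinset, hL]
  refine (Prog.ensures_ite (T := n * 15 + 6 + 2 + loopsTime n (frameTime n)) ?_ ?_).imp
    (by simp only [Term.cost]; omega) fun _ _ h => h
  · intro hn
    have hpos : 0 < n := Nat.pos_of_ne_zero hn
    refine (ensures_initRows (G := G) rfl rfl (input_adj V₁)).seq ?_
    rintro s₁ hf₁ ⟨hG₁, hoff₁⟩
    have h₁ : Listed G ∅ s₁ := by
      refine ⟨hG₁, [], ⟨List.nodup_nil, by simp⟩, ⟨?_, ?_, by simp⟩, ?_⟩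
      · exact hf₁.var vCount rfl
      · simpa using hoff₁
      · exact hf₁.var vBest rfl
    refine (ensures_loops h₁).imp le_rfl ?_
    rintro s _ ⟨-, L, hL, hs⟩
    rw [hs.outputList_eq]
    have hiff : ∀ K : Finset (Fin n), K ∈ L ↔ Maximal G.IsClique (K : Set (Fin n)) := by
      intro K
      rw [hL.mem_iff]
      constructor
      · rintro ⟨q, -, hq, rfl⟩
        exact hq.maximal
      · intro hK
        obtain ⟨q, hq⟩ := hG hpos K hK
        exact ⟨q, Set.mem_univ q, hq⟩
    exact ⟨hL.nodup, hiff, hs.best.trans (hbest L hiff).symm⟩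
  -- Without vertices, the program lists one row, of length `0`, which is the set `∅`.
  · intro hn
    obtain rfl : n = 0 := hn
    refine Prog.ensures_assign (by simp only [Term.cost]; omega) ?_
    have hL : outputList 0 ((input G V₁).setVar vCount ((Term.const 1).eval (input G V₁))) =
        [∅] := by
      simp [outputList, Term.eval, vCount, outputSet]
    have hiff : ∀ K : Finset (Fin 0), K ∈ [(∅ : Finset (Fin 0))] ↔
        Maximal G.IsClique (K : Set (Fin 0)) := by
      intro K
      obtain rfl := Subsingleton.elim K ∅
      simp only [List.mem_singleton, true_iff]
      exact ⟨by simp, fun A _ _ => (Subsingleton.elim A _).le⟩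
    rw [hL]
    refine ⟨List.nodup_singleton _, hiff, ?_⟩
    rw [hbest _ hiff]
    simp [outputNumber, input, vCount]

end

end RAM

/-- One program, on every 2SUIG given with its vertex partition, halts in time polynomial in the
number of vertices with a list of all maximal cliques, each exactly once, and the clique number. -/
theorem mainTheorem3 :
    ∃ (P : RAM.Prog) (p : Polynomial ℕ),
      ∀ (ε : ℝ), 0 < ε → ε < 1 →
      ∀ (n : ℕ) (G : SimpleGraph (Fin n)) (V₁ V₂ : Set (Fin n)), IsTwoSUIGPartition ε G V₁ V₂ →
        ∃ (s : RAM.State) (t : ℕ), P.Runs (RAM.input G V₁) s t ∧ t ≤ p.eval n ∧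
          (RAM.outputList n s).Nodup ∧
          (∀ K : Finset (Fin n), K ∈ RAM.outputList n s ↔ Maximal G.IsClique (K : Set (Fin n))) ∧
          RAM.outputNumber s = G.cliqueNum := by
  obtain ⟨p, hp⟩ : ∃ p : Polynomial ℕ, ∀ n,
      n * 15 + RAM.loopsTime n (RAM.frameTime n) + 10 = p.eval n := by
    let X : Polynomial ℕ := Polynomial.X
    let T : Polynomial ℕ := (X * 58 + 6) + ((22 + (X * (X * 38 + 14) + 6)) +
      ((2 + (X ^ 4 * (X * 28 + 24) + 6)) + (X * 15 + 30)))
    exact ⟨X * 15 + (X * ((X * ((X * ((X * (T + 8) + 6) + 8) + 6) + 8) + 6) + 8) + 6) + 10,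
      fun n => by simp [X, T, RAM.loopsTime, RAM.frameTime]⟩
  refine ⟨RAM.listCliques, p, fun ε _ _ n G V₁ V₂ hR => ?_⟩
  obtain ⟨R, -⟩ := hR
  obtain ⟨s, t, hr, ht, h⟩ := RAM.ensures_listCliques (G := G) V₁ fun hn K hK =>
    haveI : Nonempty (Fin n) := ⟨⟨0, hn⟩⟩
    R.exists_isCliqueFrame hK
  exact ⟨s, t, hr, hp n ▸ ht, h⟩
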